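/- Theorem 3.2. Let $K$ be a field and let $K\langle X\rangle=K\langle X_1,\dots,X_n\rangle$ be the free associative unital $K$-algebra, with standard $K$-basis $\mathcal B$ consisting of all monomials (words) in $X_1,\dots,X_n$. Give each $X_i$ a positive integer degree $m_i$, and let $K\langle X\rangle=\bigoplus_{p\in\mathbb N}K\langle X\rangle_p$ be the resulting gradation, where $K\langle X\rangle_p$ is the span of the monomials of degree $p$. Let $\prec$ be a monomial ordering on $\mathcal B$, that is, a well-ordering such that $u\prec v$ implies $wus\prec wvs$, and $u\prec wus$ whenever $w\neq 1$ or $s\neq 1$, for all $w,u,v,s\in\mathcal B$. For $f\neq 0$ let $\mathbf{LM}(f)$ be the $\prec$-largest monomial occurring in $f$ with nonzero coefficient, and for $S\subseteq K\langle X\rangle$ put $\mathbf{LM}(S)=\{\mathbf{LM}(f) : f\in S,\ f\ne 0\}$. Write $\langle U\rangle$ for the two-sided ideal generated by $U$. Let $\mathcal G$ be a finite set of homogeneous elements of $K\langle X\rangle$ that is a Gröbner basis of $I=\langle\mathcal G\rangle$, that is, $\mathcal G\subseteq I\setminus\{0\}$ and $\langle\mathbf{LM}(I)\rangle=\langle\mathbf{LM}(\mathcal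 G)\rangle$. Suppose that $\mathbf{LM}(\mathcal G)$ contains none of the letters $X_1,\dots,X_n$ and is reduced, that is, if $u\neq v$ are in $\mathbf{LM}(\mathcal G)$, then $u\ne wvs$ for all $w,s\in\mathcal B$. If the monomial algebra $\overline A=K\langle X\rangle/\langle\mathbf{LM}(\mathcal G)\rangle$ is semiprime (that is, $a\in\overline A$ and $a\overline Aa=\{0\}$ imply $a=0$), then the algebra $A=K\langle X\rangle/I$, which is $\mathbb N$-graded by the subspaces $A_p=(K\langle X\rangle_p+I)/I$, is Jacobson semiprimitive, that is, its Jacobson radical $J(A)$ is $\{0\}$. -/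

import Mathlib

namespace FreeAlgGB

/-! Monomials (words) in the letters `X₁, …, Xₙ` are the elements of the free monoid
`FreeMonoid (Fin n)`; the empty word `1` is the monomial `1`. They index the standard `K`-basis
of the free algebra `K⟨X⟩ = FreeAlgebra K (Fin n)`. -/

/-- The monomial `w`, as an element of the free algebra `K⟨X₁, …, Xₙ⟩`. -/
noncomputable def mon (K : Type*) [Field K] {n : ℕ} (w : FreeMonoid (Fin n)) :
    FreeAlgebra K (Fin n) :=
  FreeAlgebra.basisFreeMonoid K (Fin n) w

/-- `mon` sends a word to the product of its letters. -/
theorem mon_eq_lift (K : Type*) [Field K] {n : ℕ} (w : FreeMonoid (Fin n)) :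
    mon K w = FreeMonoid.lift (FreeAlgebra.ι K) w := by
  simp [mon, FreeAlgebra.basisFreeMonoid, FreeAlgebra.equivMonoidAlgebraFreeMonoid]

/-- The coefficient of the monomial `w` in the expansion of `f` in the standard basis. -/
noncomputable def coeff {K : Type*} [Field K] {n : ℕ} (f : FreeAlgebra K (Fin n))
    (w : FreeMonoid (Fin n)) : K :=
  (FreeAlgebra.basisFreeMonoid K (Fin n)).repr f w

/-- The degree of a monomial, when the letter `X_i` has degree `m i`. -/
def wdeg {n : ℕ} (m : Fin n → ℕ) (w : FreeMonoid (Fin n)) : ℕ :=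
  ((FreeMonoid.toList w).map m).sum

/-- The homogeneous part `K⟨X⟩_p`: the span of all monomials of degree `p`. -/
noncomputable def gradedPiece (K : Type*) [Field K] {n : ℕ} (m : Fin n → ℕ) (p : ℕ) :
    Submodule K (FreeAlgebra K (Fin n)) :=
  Submodule.span K {f | ∃ w : FreeMonoid (Fin n), wdeg m w = p ∧ f = mon K w}

/-- `f` is homogeneous for the weight gradation given by `m`. -/
def IsHomog {K : Type*} [Field K] {n : ℕ} (m : Fin n → ℕ) (f : FreeAlgebra K (Fin n)) : Prop :=
  ∃ p : ℕ, f ∈ gradedPiece K m p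

/-- Monomial orderings: `r u v` is read `u ≺ v`. -/
structure IsMonomialOrder {n : ℕ} (r : FreeMonoid (Fin n) → FreeMonoid (Fin n) → Prop) :
    Prop where
  wellOrder : IsWellOrder (FreeMonoid (Fin n)) r
  mul_mul : ∀ w u v s : FreeMonoid (Fin n), r u v → r (w * u * s) (w * v * s)
  lt_mul_mul : ∀ w u s : FreeMonoid (Fin n), (w ≠ 1 ∨ s ≠ 1) → r u (w * u * s)

/-- `w` is the leading monomial of `f`: the `≺`-largest monomial with nonzero coefficient
(only a nonzero `f` has one). -/
def IsLeadingMonomial {K : Type*} [Field K] {n : ℕ}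
    (r : FreeMonoid (Fin n) → FreeMonoid (Fin n) → Prop) (f : FreeAlgebra K (Fin n))
    (w : FreeMonoid (Fin n)) : Prop :=
  coeff f w ≠ 0 ∧ ∀ v : FreeMonoid (Fin n), coeff f v ≠ 0 → v ≠ w → r v w

/-- `LM(S)`, the set of leading monomials of the (nonzero) elements of `S`. -/
def leadingMonomials {K : Type*} [Field K] {n : ℕ}
    (r : FreeMonoid (Fin n) → FreeMonoid (Fin n) → Prop) (S : Set (FreeAlgebra K (Fin n))) :
    Set (FreeMonoid (Fin n)) :=
  {w | ∃ f ∈ S, IsLeadingMonomial r f w}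

/-- The two-sided ideal `⟨Ω⟩` of `K⟨X⟩` generated by a set `Ω` of monomials. -/
noncomputable def monomialIdeal (K : Type*) [Field K] {n : ℕ} (Ω : Set (FreeMonoid (Fin n))) :
    TwoSidedIdeal (FreeAlgebra K (Fin n)) :=
  TwoSidedIdeal.span (mon K '' Ω)

/-- `G` is a Gröbner basis of the two-sided ideal `I`: it consists of nonzero elements of `I`
and `⟨LM(I)⟩ = ⟨LM(G)⟩`. -/
structure IsGroebnerBasis {K : Type*} [Field K] {n : ℕ}
    (r : FreeMonoid (Fin n) → FreeMonoid (Fin n) → Prop) (G : Set (FreeAlgebra K (Fin n)))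
    (I : TwoSidedIdeal (FreeAlgebra K (Fin n))) : Prop where
  subset : G ⊆ {f | f ∈ I ∧ f ≠ 0}
  span_eq : monomialIdeal K (leadingMonomials r {f | f ∈ I}) =
    monomialIdeal K (leadingMonomials r G)

/-- `v` divides `u`: `v` is a factor (connected subword) of `u`. -/
def WordDvd {n : ℕ} (v u : FreeMonoid (Fin n)) : Prop :=
  ∃ w s : FreeMonoid (Fin n), u = w * v * s

/-- A set of monomials is reduced if no element divides a different one. -/
def IsReducedSet {n : ℕ} (Ω : Set (FreeMonoid (Fin n))) : Prop :=
  ∀ v ∈ Ω, ∀ u ∈ Ω, v ≠ u → ¬ WordDvd v u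

/-- The quotient algebra `K⟨X⟩ / I`. -/
abbrev QuotAlg {K : Type*} [Field K] {n : ℕ} (I : TwoSidedIdeal (FreeAlgebra K (Fin n))) :=
  I.ringCon.Quotient

/-- The quotient map `K⟨X⟩ → K⟨X⟩ / I`, as a linear map. -/
def quotMap {K : Type*} [Field K] {n : ℕ} (I : TwoSidedIdeal (FreeAlgebra K (Fin n))) :
    FreeAlgebra K (Fin n) →ₗ[K] QuotAlg I where
  toFun f := (f : I.ringCon.Quotient)
  map_add' _ _ := rfl
  map_smul' _ _ := rfl

/-- The part `A_p = (K⟨X⟩_p + I) / I` of `A = K⟨X⟩ / I`: the image of `K⟨X⟩_p`. -/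
noncomputable def quotPiece {K : Type*} [Field K] {n : ℕ} (m : Fin n → ℕ)
    (I : TwoSidedIdeal (FreeAlgebra K (Fin n))) (p : ℕ) : Submodule K (QuotAlg I) :=
  (gradedPiece K m p).map (quotMap I)

/-- A ring `R` is semiprime if `a R a = 0` implies `a = 0`. -/
def IsSemiprimeRing (R : Type*) [Ring R] : Prop :=
  ∀ a : R, (∀ x : R, a * x * a = 0) → a = 0

/-- A ring is (Jacobson) semiprimitive if its Jacobson radical vanishes. -/
def IsSemiprimitiveRing (R : Type*) [Ring R] : Prop :=
  Ring.jacobson R = ⊥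

end FreeAlgGB

/-! ### The Jacobson radical under finite centralizing extensions and ring automorphisms -/

open scoped TensorProduct Polynomial

namespace Ring

theorem mem_jacobson_iff_exists {R : Type*} [Ring R] {x : R} :
    x ∈ Ring.jacobson R ↔ ∀ y, ∃ z, z * y * x + z = 1 := by
  simp [← Ideal.jacobson_bot, Ideal.mem_jacobson_iff, sub_eq_zero]

theorem exists_mul_one_sub_eq_one {R : Type*} [Ring R] {x : R} (hx : x ∈ Ring.jacobson R) :
    ∃ z, z * (1 - x) = 1 := by
  obtain ⟨z, hz⟩ := mem_jacobson_iff_exists.1 hx (-1)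
  exact ⟨z, by rw [mul_sub, mul_one, ← hz, mul_neg_one, neg_mul, neg_add_eq_sub]⟩

theorem eq_zero_of_mul_eq_one_of_mem_jacobson {R : Type*} [Ring R] {x y : R}
    (hx : x ∈ Ring.jacobson R) (h : y * x = 1) : x = 0 := by
  have h1 : (1 : R) ∈ Ring.jacobson R := h ▸ Ideal.mul_mem_left _ y hx
  obtain ⟨z, hz⟩ := exists_mul_one_sub_eq_one h1
  rw [sub_self, mul_zero] at hz
  rw [← one_mul x, ← hz, zero_mul]

theorem map_mem_jacobson {R S : Type*} [Ring R] [Ring S] (f : R →+* S)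
    (hf : Function.Surjective f) {x : R} (hx : x ∈ Ring.jacobson R) : f x ∈ Ring.jacobson S :=
  haveI : RingHomSurjective f := ⟨hf⟩
  Ring.le_comap_jacobson f hx

/-- The Jacobson radical is mapped into the Jacobson radical by a finite centralizing extension. -/
theorem map_mem_jacobson_of_centralizing {A B ι : Type*} [Ring A] [Ring B] [Finite ι] (f : A →+* B)
    (b : ι → B) (hcomm : ∀ i a, Commute (b i) (f a))
    (hgen : ∀ x, x ∈ AddSubmonoid.closure {y | ∃ i a, y = f a * b i})
    {a : A} (ha : a ∈ Ring.jacobson A) : f a ∈ Ring.jacobson B := by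
  rw [Ring.jacobson_eq_sInf_isMaximal, Ideal.mem_sInf]
  intro I hI
  have hI' : I.IsMaximal := hI
  let S := B ⧸ I
  let _ : Module A S := Module.compHom S f
  have hsm : ∀ (a : A) (s : S), a • s = f a • s := fun _ _ => rfl
  have hfin : (⊤ : Submodule A S).FG := by
    refine ⟨(Set.finite_range fun i => (Submodule.Quotient.mk (b i) : S)).toFinset, ?_⟩
    rw [eq_top_iff]
    rintro s -
    obtain ⟨x, rfl⟩ := Submodule.Quotient.mk_surjective _ s
    induction hgen x using AddSubmonoid.closure_induction with
    | mem y hy =>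
      obtain ⟨i, c, rfl⟩ := hy
      have : (Submodule.Quotient.mk (f c * b i) : S) = c • Submodule.Quotient.mk (b i) := rfl
      rw [this]
      exact Submodule.smul_mem _ _ (Submodule.subset_span (by simp))
    | zero => exact zero_mem _
    | add y z _ _ hy hz =>
      rw [Submodule.Quotient.mk_add]
      exact add_mem hy hz
  let P : Submodule A S := Ring.jacobson A • (⊤ : Submodule A S)
  have hPb : ∀ x : B, ∀ s ∈ P, x • s ∈ P := by
    intro x s hs
    induction hgen x using AddSubmonoid.closure_induction with
    | mem y hy =>
      obtain ⟨i, c, rfl⟩ := hy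
      rw [mul_smul, ← hsm]
      refine Submodule.smul_mem _ _ ?_
      induction hs using Submodule.smul_induction_on' with
      | smul r hr t _ =>
        rw [hsm, ← mul_smul, (hcomm i r).eq, mul_smul, ← hsm]
        exact Submodule.smul_mem_smul hr trivial
      | add u _ v _ hu hv => rw [smul_add]; exact add_mem hu hv
    | zero => rw [zero_smul]; exact zero_mem _
    | add y z _ _ hy hz => rw [add_smul]; exact add_mem hy hz
  let Q : Submodule B S :=
    { carrier := P
      add_mem' := fun h h' => add_mem h h'
      zero_mem' := P.zero_mem
      smul_mem' := fun x s hs => hPb x s hs }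
  have : IsSimpleModule B S := isSimpleModule_iff_isCoatom.mpr (Ideal.isMaximal_def.1 hI')
  have hQ : Q = ⊥ := by
    refine (eq_bot_or_eq_top Q).resolve_right fun h => ?_
    have hP : (⊤ : Submodule A S) ≤ P := fun s _ => by
      have : s ∈ Q := h ▸ trivial
      exact this
    have h0 := hfin.eq_bot_of_le_jacobson_smul hP
    have := IsSimpleModule.nontrivial B S
    obtain ⟨s, hs⟩ := exists_ne (0 : S)
    exact hs ((Submodule.mem_bot A).1 (h0 ▸ trivial))
  have hmem : (a • (Submodule.Quotient.mk 1 : S)) ∈ Q :=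
    Submodule.smul_mem_smul (N := (⊤ : Submodule A S)) ha trivial
  rw [hQ, Submodule.mem_bot, hsm, ← Submodule.Quotient.mk_smul, Submodule.Quotient.mk_eq_zero,
    smul_eq_mul, mul_one] at hmem
  exact hmem

section BaseChange

variable {K L A : Type*} [Field K] [Field L] [Algebra K L] [Ring A] [Algebra K A]

theorem one_tmul_mem_jacobson [FiniteDimensional K L] {a : A} (ha : a ∈ Ring.jacobson A) :
    (1 : L) ⊗ₜ[K] a ∈ Ring.jacobson (L ⊗[K] A) := by
  let b := Module.finBasis K L
  refine map_mem_jacobson_of_centralizing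
    (Algebra.TensorProduct.includeRight : A →ₐ[K] L ⊗[K] A).toRingHom
    (fun i => b i ⊗ₜ[K] (1 : A)) (fun i a => ?_) (fun x => ?_) ha
  · simp [Commute, SemiconjBy]
  · induction x with
    | zero => exact zero_mem _
    | add x y hx hy => exact add_mem hx hy
    | tmul l a =>
      rw [← b.sum_repr l, TensorProduct.sum_tmul]
      refine sum_mem fun i _ => AddSubmonoid.subset_closure ⟨i, b.repr l i • a, ?_⟩
      simp [TensorProduct.smul_tmul]

theorem mem_jacobson_of_one_tmul {a : A}
    (ha : (1 : L) ⊗ₜ[K] a ∈ Ring.jacobson (L ⊗[K] A)) : a ∈ Ring.jacobson A := by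
  obtain ⟨l, hl⟩ := (Algebra.linearMap K L).exists_leftInverse_of_injective
    (LinearMap.ker_eq_bot.2 (algebraMap K L).injective)
  let π : L ⊗[K] A →ₗ[K] A := (TensorProduct.lid K A).toLinearMap ∘ₗ l.rTensor A
  have hl1 : l 1 = 1 := by simpa using LinearMap.congr_fun hl 1
  have hπ : ∀ x y, π (x * 1 ⊗ₜ y) = π x * y := by
    intro x y
    induction x with
    | zero => simp
    | add x z hx hz => rw [add_mul, map_add, hx, hz, map_add, add_mul]
    | tmul l a => simp [π]
  rw [mem_jacobson_iff_exists] at ha ⊢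
  intro y
  obtain ⟨z, hz⟩ := ha (1 ⊗ₜ y)
  refine ⟨π z, ?_⟩
  have := congrArg π hz
  rw [map_add, mul_assoc, Algebra.TensorProduct.tmul_mul_tmul, one_mul, hπ, ← mul_assoc] at this
  rw [this]
  simp [π, Algebra.TensorProduct.one_def, hl1]

end BaseChange

end Ring

/-- Some finite extension of a field has as many nonzero elements as desired. -/
theorem exists_finiteDimensional_extension_finset (K : Type*) [Field K] (N : ℕ) :
    ∃ (L : IntermediateField K (AlgebraicClosure K)), FiniteDimensional K L ∧
      ∃ s : Finset L, s.card = N ∧ ∀ x ∈ s, x ≠ 0 := by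
  classical
  obtain ⟨t, ht⟩ := Infinite.exists_subset_card_eq (AlgebraicClosure K) (N + 1)
  let L := IntermediateField.adjoin K (t : Set (AlgebraicClosure K))
  have : FiniteDimensional K L :=
    IntermediateField.finiteDimensional_adjoin fun x _ => Algebra.IsIntegral.isIntegral x
  have hinj : Function.Injective fun x : t =>
      (⟨x, IntermediateField.subset_adjoin K _ x.2⟩ : L) := by
    intro x y h
    exact Subtype.ext (congrArg (fun z : L => (z : AlgebraicClosure K)) h)
  let s : Finset L := Finset.univ.image fun x : t =>
      (⟨x, IntermediateField.subset_adjoin K _ x.2⟩ : L)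
  have hs : s.card = N + 1 := by
    rw [Finset.card_image_of_injective _ hinj]; simpa using ht
  have hs' : N ≤ (s.erase 0).card := by
    have := Finset.pred_card_le_card_erase (s := s) (a := 0)
    omega
  obtain ⟨u, hu, huN⟩ := Finset.exists_subset_card_eq hs'
  exact ⟨L, inferInstance, u, huN, fun x hx => Finset.ne_of_mem_erase (hu hx)⟩

/-- If a polynomial with coefficients in a vector space has more roots than its formal degree,
all of its coefficients vanish. -/
theorem eq_zero_of_sum_pow_smul_eq_zero {L V : Type*} [Field L] [AddCommGroup V] [Module L V]
    (N : ℕ) (v : ℕ → V) (s : Finset L) (hs : N ≤ s.card)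
    (h : ∀ x ∈ s, ∑ i ∈ Finset.range N, x ^ i • v i = 0) (i : ℕ) (hi : i < N) : v i = 0 := by
  rw [← Module.forall_dual_apply_eq_zero_iff L]
  intro φ
  let P : L[X] := ∑ i ∈ Finset.range N, Polynomial.monomial i (φ (v i))
  have hP : P = 0 := by
    refine Polynomial.eq_zero_of_degree_lt_of_eval_finset_eq_zero s ?_ fun x hx => ?_
    · refine lt_of_lt_of_le ?_ (Nat.cast_le.2 hs)
      rw [← Polynomial.mem_degreeLT]
      refine sum_mem fun i hi => ?_
      rw [Polynomial.mem_degreeLT]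
      exact (Polynomial.degree_monomial_le _ _).trans_lt (by simpa using hi)
    · have := congrArg φ (h x hx)
      simpa [P, Polynomial.eval_finsetSum, mul_comm] using this
  have := congrArg (fun p => Polynomial.coeff p i) hP
  simpa [P, Polynomial.finsetSum_coeff, Polynomial.coeff_monomial, hi] using this

section Coaction

variable {K A : Type*} [Field K] [Ring A] [Algebra K A]

/-- A polynomial coaction `θ : A → A[T]` encodes an `ℕ`-grading of `A`: the component of degree `p`
of `a` is the coefficient of `T ^ p` in `θ a`. -/
structure IsGradingCoaction (θ : A →ₐ[K] A[X]) : Prop where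
  eval_one : ∀ a, (θ a).eval 1 = a
  coaction : ∀ a p, θ ((θ a).coeff p) = Polynomial.monomial p ((θ a).coeff p)

variable {θ : A →ₐ[K] A[X]}

/-- The dilation by `x` on the scalar extension of an algebra with a grading coaction. -/
noncomputable def dilation {L : Type*} [Field L] [Algebra K L] (θ : A →ₐ[K] A[X]) (x : L) :
    L ⊗[K] A →ₐ[L] L ⊗[K] A :=
  Algebra.TensorProduct.lift (Algebra.ofId L (L ⊗[K] A))
    ((Polynomial.eval₂AlgHom (Algebra.TensorProduct.includeRight : A →ₐ[K] L ⊗[K] A)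
      (x ⊗ₜ[K] (1 : A)) (fun a => by simp [Commute, SemiconjBy])).comp θ)
    (fun l _ => Algebra.commutes l _)

variable {L : Type*} [Field L] [Algebra K L]

theorem dilation_one_tmul (x : L) (a : A) {N : ℕ} (hN : (θ a).natDegree < N) :
    dilation θ x (1 ⊗ₜ a) = ∑ p ∈ Finset.range N, x ^ p • ((1 : L) ⊗ₜ[K] (θ a).coeff p) := by
  have : dilation θ x (1 ⊗ₜ a) =
      (θ a).eval₂ (Algebra.TensorProduct.includeRight : A →ₐ[K] L ⊗[K] A).toRingHom
        (x ⊗ₜ[K] (1 : A)) := by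
    refine (Algebra.TensorProduct.lift_tmul _ _ _ _ _).trans ?_
    rw [map_one, one_mul]
    rfl
  rw [this, Polynomial.eval₂_eq_sum_range' _ hN]
  refine Finset.sum_congr rfl fun p _ => ?_
  simp [TensorProduct.smul_tmul']

theorem IsGradingCoaction.sum_coeff (hθ : IsGradingCoaction θ) (a : A) {N : ℕ}
    (hN : (θ a).natDegree < N) : ∑ p ∈ Finset.range N, (θ a).coeff p = a := by
  conv_rhs => rw [← hθ.eval_one a, Polynomial.eval_eq_sum_range' hN]
  simp

theorem IsGradingCoaction.dilation_dilation (hθ : IsGradingCoaction θ) (x y : L) (b : L ⊗[K] A) :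
    dilation θ x (dilation θ y b) = dilation θ (x * y) b := by
  induction b with
  | zero => simp
  | add b c hb hc => simp [hb, hc]
  | tmul l a =>
    have hl : l ⊗ₜ[K] a = l • ((1 : L) ⊗ₜ[K] a) := by simp [TensorProduct.smul_tmul']
    rw [hl, map_smul, map_smul, map_smul, dilation_one_tmul y a (Nat.lt_succ_self _),
      dilation_one_tmul _ a (Nat.lt_succ_self _), map_sum]
    congr 1
    refine Finset.sum_congr rfl fun p hp => ?_
    have h1 : (θ ((θ a).coeff p)).natDegree < (θ a).natDegree.succ := by
      rw [hθ.coaction]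
      exact (Polynomial.natDegree_monomial_le _).trans_lt (Finset.mem_range.1 hp)
    rw [map_smul, dilation_one_tmul x _ h1, hθ.coaction, Finset.sum_eq_single_of_mem p hp]
    · simp [mul_pow, smul_smul, mul_comm]
    · intro q _ hq
      simp [Polynomial.coeff_monomial, hq.symm]

theorem IsGradingCoaction.dilation_one (hθ : IsGradingCoaction θ) (b : L ⊗[K] A) :
    dilation θ (1 : L) b = b := by
  induction b with
  | zero => simp
  | add b c hb hc => simp [hb, hc]
  | tmul l a =>
    have hl : l ⊗ₜ[K] a = l • ((1 : L) ⊗ₜ[K] a) := by simp [TensorProduct.smul_tmul']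
    rw [hl, map_smul, dilation_one_tmul _ a (Nat.lt_succ_self _)]
    simp only [one_pow, one_smul, ← TensorProduct.tmul_sum]
    rw [hθ.sum_coeff a (Nat.lt_succ_self _)]

/-- The Jacobson radical of an `ℕ`-graded algebra over a field is a graded ideal. -/
theorem IsGradingCoaction.coeff_mem_jacobson (hθ : IsGradingCoaction θ) {a : A}
    (ha : a ∈ Ring.jacobson A) (p : ℕ) : (θ a).coeff p ∈ Ring.jacobson A := by
  by_cases hp : p < (θ a).natDegree + 1
  swap
  · rw [Polynomial.coeff_eq_zero_of_natDegree_lt (by omega)]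
    exact zero_mem _
  obtain ⟨L, _, s, hs, hs0⟩ :=
    exists_finiteDimensional_extension_finset K ((θ a).natDegree + 1)
  apply Ring.mem_jacobson_of_one_tmul (L := L) (K := K)
  let J : Submodule L (L ⊗[K] A) := (Ring.jacobson (L ⊗[K] A)).restrictScalars L
  have hJ : ∀ b, J.mkQ b = 0 ↔ b ∈ Ring.jacobson (L ⊗[K] A) := fun b => by simp [J]
  rw [← hJ]
  refine eq_zero_of_sum_pow_smul_eq_zero ((θ a).natDegree + 1)
    (fun p => J.mkQ ((1 : L) ⊗ₜ[K] (θ a).coeff p)) s hs.ge (fun x hx => ?_) p hp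
  simp_rw [← map_smul]
  rw [← map_sum, ← dilation_one_tmul x a (Nat.lt_succ_self _), hJ]
  refine Ring.map_mem_jacobson (dilation θ x).toRingHom (fun b => ⟨dilation θ x⁻¹ b, ?_⟩)
    (Ring.one_tmul_mem_jacobson ha)
  simp [hθ.dilation_dilation, hs0 x hx, hθ.dilation_one]

/-- Homogeneous elements of positive degree in the Jacobson radical are nilpotent. -/
theorem isNilpotent_of_mem_jacobson {c : A} (hc : c ∈ Ring.jacobson A) {d : ℕ} (hd : 0 < d)
    (hθc : θ c = Polynomial.monomial d c) : IsNilpotent c := by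
  obtain ⟨b, hb⟩ := Ring.exists_mul_one_sub_eq_one hc
  have h1 : θ b * (1 - Polynomial.monomial d c) = 1 := by
    rw [← hθc, ← map_one θ, ← map_sub, ← map_mul, hb]
  let N := (θ b).natDegree + 1
  refine ⟨N, ?_⟩
  have h2 : θ b * (1 - Polynomial.monomial d c ^ (N + 1)) =
      ∑ i ∈ Finset.range (N + 1), Polynomial.monomial d c ^ i := by
    rw [← mul_neg_geom_sum, ← mul_assoc, h1, one_mul]
  have hdN : N ≤ d * N := Nat.le_mul_of_pos_left _ hd
  have h3 := congrArg (fun p => Polynomial.coeff p (d * N)) h2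
  simp only [Polynomial.monomial_pow, mul_sub, mul_one, Polynomial.coeff_sub,
    Polynomial.finsetSum_coeff, Polynomial.coeff_monomial] at h3
  rw [Polynomial.coeff_eq_zero_of_natDegree_lt (by omega : (θ b).natDegree < d * N),
    ← Polynomial.C_mul_X_pow_eq_monomial, ← mul_assoc, Polynomial.coeff_mul_X_pow',
    if_neg (by rw [not_le]; exact Nat.mul_lt_mul_of_pos_left (Nat.lt_succ_self _) hd),
    Finset.sum_eq_single_of_mem N (Finset.self_mem_range_succ _)] at h3
  · simpa using h3.symm
  · intro i _ hi
    rw [if_neg]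
    intro h
    exact hi (Nat.eq_of_mul_eq_mul_left hd h)

end Coaction

namespace FreeAlgGB

open scoped Polynomial

section Monomials

variable {K : Type*} [Field K] {n : ℕ}

theorem mon_one : mon K (1 : FreeMonoid (Fin n)) = 1 := by simp [mon_eq_lift]

theorem mon_mul (u v : FreeMonoid (Fin n)) : mon K (u * v) = mon K u * mon K v := by
  simp [mon_eq_lift]

theorem wdeg_one (m : Fin n → ℕ) : wdeg m 1 = 0 := rfl

theorem wdeg_mul (m : Fin n → ℕ) (u v : FreeMonoid (Fin n)) :
    wdeg m (u * v) = wdeg m u + wdeg m v := by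
  simp [wdeg]

theorem wdeg_pos {m : Fin n → ℕ} (hm : ∀ i, 0 < m i) {w : FreeMonoid (Fin n)} (hw : w ≠ 1) :
    0 < wdeg m w := by
  induction w using FreeMonoid.casesOn with
  | one => exact absurd rfl hw
  | of_mul i w =>
    rw [wdeg_mul]
    have : wdeg m (FreeMonoid.of i) = m i := by simp [wdeg]
    have := hm i
    omega

theorem mon_induction {P : FreeAlgebra K (Fin n) → Prop} (hmon : ∀ w, P (mon K w)) (hzero : P 0)
    (hadd : ∀ f g, P f → P g → P (f + g)) (hsmul : ∀ (c : K) f, P f → P (c • f))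
    (f : FreeAlgebra K (Fin n)) : P f := by
  have hf : f ∈ Submodule.span K (Set.range (FreeAlgebra.basisFreeMonoid K (Fin n))) := by
    rw [Module.Basis.span_eq]; trivial
  induction hf using Submodule.span_induction with
  | mem x hx => obtain ⟨w, rfl⟩ := hx; exact hmon w
  | zero => exact hzero
  | add f g _ _ hf hg => exact hadd f g hf hg
  | smul c f _ hf => exact hsmul c f hf

theorem mon_mem_gradedPiece (m : Fin n → ℕ) (w : FreeMonoid (Fin n)) :
    mon K w ∈ gradedPiece K m (wdeg m w) :=
  Submodule.subset_span ⟨w, rfl, rfl⟩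

end Monomials

section Quotient

variable {K : Type*} [Field K] {n : ℕ} (I : TwoSidedIdeal (FreeAlgebra K (Fin n)))

/-- The quotient map as an algebra homomorphism. -/
noncomputable def quotAlgHom : FreeAlgebra K (Fin n) →ₐ[K] QuotAlg I := I.ringCon.mkₐ K

theorem quotAlgHom_surjective : Function.Surjective (quotAlgHom I) := I.ringCon.mk'_surjective

variable {I}

theorem quotAlgHom_eq_zero_iff {f : FreeAlgebra K (Fin n)} : quotAlgHom I f = 0 ↔ f ∈ I :=
  (RingCon.eq I.ringCon).trans (TwoSidedIdeal.mem_iff I f).symm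

theorem mem_quotPiece {m : Fin n → ℕ} {p : ℕ} {a : QuotAlg I} :
    a ∈ quotPiece m I p ↔ ∃ f ∈ gradedPiece K m p, quotAlgHom I f = a :=
  Iff.rfl

end Quotient

section QuotCoaction

variable {K : Type*} [Field K] {n : ℕ} (m : Fin n → ℕ)

/-- The homomorphism `K⟨X⟩ → (K⟨X⟩ / I)[T]` sending the letter `X_i` to `X_i T ^ (m i)`. -/
noncomputable def freeCoaction (I : TwoSidedIdeal (FreeAlgebra K (Fin n))) :
    FreeAlgebra K (Fin n) →ₐ[K] (QuotAlg I)[X] :=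
  FreeAlgebra.lift K fun i => Polynomial.monomial (m i) (quotAlgHom I (FreeAlgebra.ι K i))

variable {m}

theorem freeCoaction_mon (I : TwoSidedIdeal (FreeAlgebra K (Fin n))) (w : FreeMonoid (Fin n)) :
    freeCoaction m I (mon K w) = Polynomial.monomial (wdeg m w) (quotAlgHom I (mon K w)) := by
  induction w using FreeMonoid.inductionOn with
  | one => simp [mon_one, wdeg_one]
  | of i => simp [mon_eq_lift, freeCoaction, wdeg]
  | mul u v hu hv =>
    rw [mon_mul, map_mul, hu, hv, Polynomial.monomial_mul_monomial, wdeg_mul,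
      map_mul (quotAlgHom I)]

theorem freeCoaction_of_mem_gradedPiece (I : TwoSidedIdeal (FreeAlgebra K (Fin n))) {p : ℕ}
    {f : FreeAlgebra K (Fin n)} (hf : f ∈ gradedPiece K m p) :
    freeCoaction m I f = Polynomial.monomial p (quotAlgHom I f) := by
  induction hf using Submodule.span_induction with
  | mem x hx => obtain ⟨w, rfl, rfl⟩ := hx; exact freeCoaction_mon I w
  | zero => simp
  | add f g _ _ hf hg => rw [map_add, hf, hg, map_add, map_add]
  | smul c f _ hf => rw [map_smul, hf, map_smul, Polynomial.smul_monomial]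

variable {G : Set (FreeAlgebra K (Fin n))} (hhom : ∀ g ∈ G, IsHomog m g)

include hhom in
theorem span_le_ker_freeCoaction :
    TwoSidedIdeal.span G ≤ TwoSidedIdeal.ker (freeCoaction m (TwoSidedIdeal.span G)) := by
  rw [TwoSidedIdeal.span_le]
  intro g hg
  obtain ⟨p, hp⟩ := hhom g hg
  rw [SetLike.mem_coe, TwoSidedIdeal.mem_ker, freeCoaction_of_mem_gradedPiece _ hp,
    quotAlgHom_eq_zero_iff.2 (TwoSidedIdeal.subset_span hg), map_zero]

/-- The grading coaction on the quotient by an ideal generated by homogeneous elements. -/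
noncomputable def quotCoaction :
    QuotAlg (TwoSidedIdeal.span G) →ₐ[K] (QuotAlg (TwoSidedIdeal.span G))[X] :=
  RingCon.liftₐ _ (freeCoaction m (TwoSidedIdeal.span G)) fun x y h => by
    have := span_le_ker_freeCoaction hhom
      ((TwoSidedIdeal.rel_iff (TwoSidedIdeal.span G) x y).1 h)
    rw [TwoSidedIdeal.mem_ker, map_sub, sub_eq_zero] at this
    exact this

theorem quotCoaction_quotAlgHom (f : FreeAlgebra K (Fin n)) :
    quotCoaction hhom (quotAlgHom _ f) = freeCoaction m (TwoSidedIdeal.span G) f :=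
  rfl

theorem quotCoaction_of_mem_quotPiece {p : ℕ} {a : QuotAlg (TwoSidedIdeal.span G)}
    (ha : a ∈ quotPiece m (TwoSidedIdeal.span G) p) :
    quotCoaction hhom a = Polynomial.monomial p a := by
  obtain ⟨f, hf, rfl⟩ := mem_quotPiece.1 ha
  rw [quotCoaction_quotAlgHom, freeCoaction_of_mem_gradedPiece _ hf]

theorem coeff_quotCoaction_mem (a : QuotAlg (TwoSidedIdeal.span G)) (p : ℕ) :
    (quotCoaction hhom a).coeff p ∈ quotPiece m (TwoSidedIdeal.span G) p := by
  obtain ⟨f, rfl⟩ := quotAlgHom_surjective _ a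
  rw [quotCoaction_quotAlgHom]
  induction f using mon_induction with
  | hmon w =>
    rw [freeCoaction_mon, Polynomial.coeff_monomial]
    split_ifs with h
    · exact mem_quotPiece.2 ⟨_, h ▸ mon_mem_gradedPiece m w, rfl⟩
    · exact zero_mem _
  | hzero => simp
  | hadd f g hf hg => rw [map_add, Polynomial.coeff_add]; exact add_mem hf hg
  | hsmul c f hf => rw [map_smul, Polynomial.coeff_smul]; exact Submodule.smul_mem _ _ hf

theorem isGradingCoaction_quotCoaction : IsGradingCoaction (quotCoaction hhom) where
  eval_one a := by
    obtain ⟨f, rfl⟩ := quotAlgHom_surjective _ a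
    rw [quotCoaction_quotAlgHom]
    induction f using mon_induction with
    | hmon w => simp [freeCoaction_mon]
    | hzero => simp
    | hadd f g hf hg => rw [map_add, Polynomial.eval_add, hf, hg, map_add]
    | hsmul c f hf => rw [map_smul, Polynomial.eval_smul, hf, map_smul]
  coaction a p := quotCoaction_of_mem_quotPiece hhom (coeff_quotCoaction_mem hhom a p)

include hhom in
/-- The quotient by an ideal generated by homogeneous elements is graded. -/
theorem nonempty_gradedAlgebra_quotPiece :
    Nonempty (GradedAlgebra (quotPiece m (TwoSidedIdeal.span G))) := by
  have hint : DirectSum.IsInternal (quotPiece m (TwoSidedIdeal.span G)) := by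
    constructor
    · rw [injective_iff_map_eq_zero]
      intro x hx
      have key : ∀ y : DirectSum ℕ fun p => quotPiece m (TwoSidedIdeal.span G) p, ∀ p,
          (quotCoaction hhom (DirectSum.coeAddMonoidHom _ y)).coeff p = y p := by
        intro y p
        induction y using DirectSum.induction_on with
        | zero => simp
        | of i y =>
          rw [DirectSum.coeAddMonoidHom_of, quotCoaction_of_mem_quotPiece hhom y.2,
            Polynomial.coeff_monomial]
          split_ifs with h
          · subst h; rw [DirectSum.of_eq_same]
          · rw [DirectSum.of_eq_of_ne _ _ _ (Ne.symm h)]; rfl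
        | add y z hy hz =>
          rw [map_add, map_add, Polynomial.coeff_add, hy, hz, DirectSum.add_apply,
            Submodule.coe_add]
      ext p
      rw [← key, hx]
      simp
    · intro a
      refine ⟨∑ p ∈ Finset.range ((quotCoaction hhom a).natDegree + 1),
        DirectSum.of (fun p => quotPiece m (TwoSidedIdeal.span G) p) p
          ⟨_, coeff_quotCoaction_mem hhom a p⟩, ?_⟩
      simp only [map_sum, DirectSum.coeAddMonoidHom_of]
      exact (isGradingCoaction_quotCoaction hhom).sum_coeff a (Nat.lt_succ_self _)
  refine ⟨{ hint.chooseDecomposition with one_mem := ?_, mul_mem := ?_ }⟩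
  · refine mem_quotPiece.2 ⟨1, ?_, map_one _⟩
    rw [← mon_one]
    exact mon_mem_gradedPiece m 1
  · intro p q a b ha hb
    have h : quotCoaction hhom (a * b) = Polynomial.monomial (p + q) (a * b) := by
      rw [map_mul, quotCoaction_of_mem_quotPiece hhom ha, quotCoaction_of_mem_quotPiece hhom hb,
        Polynomial.monomial_mul_monomial]
    have := coeff_quotCoaction_mem hhom (a * b) (p + q)
    rwa [h, Polynomial.coeff_monomial_same] at this

end QuotCoaction

end FreeAlgGB

namespace FreeAlgGB

section Words

variable {n : ℕ} {Ω : Set (FreeMonoid (Fin n))}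

/-- A word is normal with respect to `Ω` if no element of `Ω` divides it. -/
def IsNormalWord (Ω : Set (FreeMonoid (Fin n))) (u : FreeMonoid (Fin n)) : Prop :=
  ∀ v ∈ Ω, ¬ WordDvd v u

theorem WordDvd.mul_mul {v u : FreeMonoid (Fin n)} (h : WordDvd v u) (a b : FreeMonoid (Fin n)) :
    WordDvd v (a * u * b) := by
  obtain ⟨w, s, rfl⟩ := h
  exact ⟨a * w, s * b, by simp only [mul_assoc]⟩

theorem IsNormalWord.of_mul_right {u b : FreeMonoid (Fin n)} (h : IsNormalWord Ω (u * b)) :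
    IsNormalWord Ω u := fun v hv hd => h v hv (by simpa using hd.mul_mul 1 b)

/-- A factor of `a * u * b` which is not much longer than `u` lies in `a * u` or in `u * b`. -/
theorem WordDvd.of_overlap {v a u b : FreeMonoid (Fin n)} (hlen : v.length ≤ u.length)
    (h : WordDvd v (a * u * b)) : WordDvd v (a * u) ∨ WordDvd v (u * b) := by
  obtain ⟨s, t, h⟩ := h
  have h' : a.toList ++ u.toList ++ b.toList = s.toList ++ v.toList ++ t.toList := h
  have hlen' : v.toList.length ≤ u.toList.length := hlen
  have hl := congrArg List.length h'
  simp only [List.length_append] at hl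
  by_cases hc : (s.toList ++ v.toList).length ≤ (a.toList ++ u.toList).length
  · left
    obtain ⟨x, hx⟩ := List.prefix_of_prefix_length_le (l₃ := a.toList ++ u.toList ++ b.toList)
      ⟨t.toList, h'.symm⟩ ⟨b.toList, rfl⟩ hc
    exact ⟨s, FreeMonoid.ofList x, hx.symm⟩
  · right
    simp only [List.length_append] at hc
    obtain ⟨x, hx⟩ := List.suffix_of_suffix_length_le (l₁ := v.toList ++ t.toList)
      (l₂ := u.toList ++ b.toList) (l₃ := a.toList ++ u.toList ++ b.toList)
      ⟨s.toList, by rw [h', List.append_assoc]⟩ ⟨a.toList, by rw [List.append_assoc]⟩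
      (by simp only [List.length_append]; omega)
    refine ⟨FreeMonoid.ofList x, t, ?_⟩
    rw [mul_assoc]
    exact hx.symm

theorem IsNormalWord.overlap {a u b : FreeMonoid (Fin n)} (hlen : ∀ v ∈ Ω, v.length ≤ u.length)
    (h₁ : IsNormalWord Ω (a * u)) (h₂ : IsNormalWord Ω (u * b)) : IsNormalWord Ω (a * u * b) :=
  fun v hv hd => (hd.of_overlap (hlen v hv)).elim (h₁ v hv) (h₂ v hv)

theorem IsNormalWord.pow {u w : FreeMonoid (Fin n)} (hlen : ∀ v ∈ Ω, v.length ≤ u.length)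
    (h : IsNormalWord Ω (u * w * u)) (k : ℕ) : IsNormalWord Ω ((u * w) ^ k) := by
  suffices IsNormalWord Ω ((u * w) ^ k * u) from this.of_mul_right
  induction k with
  | zero =>
    rw [pow_zero, one_mul]
    rw [mul_assoc] at h
    exact h.of_mul_right
  | succ k ih =>
    have := ih.overlap hlen (b := w * u) (by rwa [← mul_assoc])
    simpa only [pow_succ, mul_assoc] using this

theorem IsNormalWord.exists_long (hret : ∀ u, IsNormalWord Ω u → ∃ w, IsNormalWord Ω (u * w * u))
    {u : FreeMonoid (Fin n)} (hu : IsNormalWord Ω u) (hu1 : u ≠ 1) (N : ℕ) :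
    ∃ x, IsNormalWord Ω (u * x * u) ∧ N ≤ (u * x * u).length := by
  induction N with
  | zero =>
    obtain ⟨x, hx⟩ := hret u hu
    exact ⟨x, hx, Nat.zero_le _⟩
  | succ N ih =>
    obtain ⟨x, hx, hN⟩ := ih
    obtain ⟨y, hy⟩ := hret _ hx
    refine ⟨x * u * y * u * x, by simpa only [mul_assoc] using hy, ?_⟩
    have hpos : 0 < u.length := Nat.pos_of_ne_zero fun h => hu1 (FreeMonoid.length_eq_zero.1 h)
    simp only [FreeMonoid.length_mul] at hN ⊢
    omega

end Words

section MonomialIdeal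

variable {K : Type*} [Field K] {n : ℕ}

theorem mul_mem_span_mon {S T U : Set (FreeMonoid (Fin n))} (h : ∀ s ∈ S, ∀ t ∈ T, s * t ∈ U)
    {f g : FreeAlgebra K (Fin n)} (hf : f ∈ Submodule.span K (mon K '' S))
    (hg : g ∈ Submodule.span K (mon K '' T)) : f * g ∈ Submodule.span K (mon K '' U) := by
  have := Submodule.mul_mem_mul hf hg
  rw [Submodule.span_mul_span] at this
  refine Submodule.span_mono ?_ this
  rintro _ ⟨_, ⟨s, hs, rfl⟩, _, ⟨t, ht, rfl⟩, rfl⟩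
  exact ⟨s * t, h s hs t ht, mon_mul s t⟩

theorem mem_span_mon_iff {S : Set (FreeMonoid (Fin n))} {f : FreeAlgebra K (Fin n)} :
    f ∈ Submodule.span K (mon K '' S) ↔ ∀ w, coeff f w ≠ 0 → w ∈ S := by
  refine (FreeAlgebra.basisFreeMonoid K (Fin n)).mem_span_image.trans ?_
  simp only [Set.subset_def, Finset.mem_coe, Finsupp.mem_support_iff]
  rfl

theorem mem_span_mon_univ (f : FreeAlgebra K (Fin n)) :
    f ∈ Submodule.span K (mon K '' Set.univ) := mem_span_mon_iff.2 fun _ _ => trivial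

theorem coeff_mon (u w : FreeMonoid (Fin n)) [Decidable (u = w)] :
    coeff (mon K u) w = if u = w then 1 else 0 := by
  simp only [coeff, mon, Module.Basis.repr_self, Finsupp.single_apply]

theorem mon_mem_monomialIdeal_iff {Ω : Set (FreeMonoid (Fin n))} {u : FreeMonoid (Fin n)} :
    mon K u ∈ monomialIdeal K Ω ↔ ¬ IsNormalWord Ω u := by
  classical
  constructor
  · intro h
    let N : Set (FreeMonoid (Fin n)) := {u | ¬ IsNormalWord Ω u}
    have hleft : ∀ s ∈ Set.univ, ∀ t ∈ N, s * t ∈ N := fun s _ t ht hst =>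
      ht fun v hv hd => hst v hv (by simpa using hd.mul_mul s 1)
    have hright : ∀ s ∈ N, ∀ t ∈ Set.univ, s * t ∈ N := fun s hs t _ hst => hs hst.of_mul_right
    let M : Submodule K (FreeAlgebra K (Fin n)) := Submodule.span K (mon K '' N)
    let I : TwoSidedIdeal (FreeAlgebra K (Fin n)) := TwoSidedIdeal.mk' M M.zero_mem
      (fun h h' => M.add_mem h h') (fun h => M.neg_mem h)
      (fun {x _} h => mul_mem_span_mon hleft (mem_span_mon_univ x) h)
      (fun {_ y} h => mul_mem_span_mon hright h (mem_span_mon_univ y))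
    have hI : ∀ x, x ∈ I ↔ x ∈ M := fun x => TwoSidedIdeal.mem_mk' _ _ _ _ _ _ x
    have hle : monomialIdeal K Ω ≤ I := by
      rw [monomialIdeal, TwoSidedIdeal.span_le]
      rintro _ ⟨v, hv, rfl⟩
      exact (hI _).2 (Submodule.subset_span ⟨v, fun hn => hn v hv ⟨1, 1, by simp⟩, rfl⟩)
    exact mem_span_mon_iff.1 ((hI _).1 (hle h)) u (by simp [coeff_mon])
  · intro h
    simp only [IsNormalWord, not_forall, not_not] at h
    obtain ⟨v, hv, w, s, rfl⟩ := h
    rw [mon_mul, mon_mul]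
    exact TwoSidedIdeal.mul_mem_right _ _ _ (TwoSidedIdeal.mul_mem_left _ _ _
      (TwoSidedIdeal.subset_span ⟨v, hv, rfl⟩))

/-- In a semiprime monomial algebra, every normal word returns to itself. -/
theorem IsSemiprimeRing.exists_isNormalWord {Ω : Set (FreeMonoid (Fin n))}
    (h : IsSemiprimeRing (QuotAlg (monomialIdeal K Ω))) {u : FreeMonoid (Fin n)}
    (hu : IsNormalWord Ω u) : ∃ w, IsNormalWord Ω (u * w * u) := by
  by_contra! hw
  refine mon_mem_monomialIdeal_iff.1 (quotAlgHom_eq_zero_iff.1 (h _ fun x => ?_)) hu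
  obtain ⟨f, rfl⟩ := quotAlgHom_surjective _ x
  induction f using mon_induction with
  | hmon w =>
    rw [← map_mul, ← map_mul, ← mon_mul, ← mon_mul, quotAlgHom_eq_zero_iff]
    exact mon_mem_monomialIdeal_iff.2 (hw w)
  | hzero => simp
  | hadd f g hf hg => rw [map_add, mul_add, add_mul, hf, hg, add_zero]
  | hsmul c f hf => rw [map_smul, mul_smul_comm, smul_mul_assoc, hf, smul_zero]

end MonomialIdeal

section LeadingMonomial

variable {K : Type*} [Field K] {n : ℕ} {r : FreeMonoid (Fin n) → FreeMonoid (Fin n) → Prop}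
  {f g : FreeAlgebra K (Fin n)} {u v : FreeMonoid (Fin n)}

theorem IsMonomialOrder.mul_left (hr : IsMonomialOrder r) (w : FreeMonoid (Fin n)) (h : r u v) :
    r (w * u) (w * v) := by
  simpa using hr.mul_mul w u v 1 h

theorem IsMonomialOrder.mul_right (hr : IsMonomialOrder r) (w : FreeMonoid (Fin n)) (h : r u v) :
    r (u * w) (v * w) := by
  simpa using hr.mul_mul 1 u v w h

theorem IsMonomialOrder.one_lt (hr : IsMonomialOrder r) (hu : u ≠ 1) : r 1 u := by
  simpa using hr.lt_mul_mul u 1 1 (Or.inl hu)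

theorem IsMonomialOrder.irrefl (hr : IsMonomialOrder r) (u : FreeMonoid (Fin n)) : ¬ r u u :=
  have := hr.wellOrder
  irrefl_of r u

theorem IsMonomialOrder.trans (hr : IsMonomialOrder r) {w : FreeMonoid (Fin n)} (h : r u v)
    (h' : r v w) : r u w :=
  have := hr.wellOrder
  trans_of r h h'

theorem IsLeadingMonomial.unique (hr : IsMonomialOrder r) (hu : IsLeadingMonomial r f u)
    (hv : IsLeadingMonomial r f v) : u = v := by
  by_contra h
  exact hr.irrefl u (hr.trans (hv.2 u hu.1 h) (hu.2 v hv.1 (Ne.symm h)))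

theorem exists_isLeadingMonomial (hr : IsMonomialOrder r) (hf : f ≠ 0) :
    ∃ u, IsLeadingMonomial r f u := by
  classical
  have := hr.wellOrder
  let _ : LinearOrder (FreeMonoid (Fin n)) := linearOrderOfSTO r
  have hs : ((FreeAlgebra.basisFreeMonoid K (Fin n)).repr f).support.Nonempty := by
    rw [Finsupp.support_nonempty_iff]
    simpa using hf
  refine ⟨_, Finsupp.mem_support_iff.1 (Finset.max'_mem _ hs), fun v hv hne => ?_⟩
  exact lt_of_le_of_ne (Finset.le_max' _ v (Finsupp.mem_support_iff.2 hv)) hne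

theorem isLeadingMonomial_iff (hr : IsMonomialOrder r) : IsLeadingMonomial r f u ↔
    ∃ c : K, c ≠ 0 ∧ f - c • mon K u ∈ Submodule.span K (mon K '' {v | r v u}) := by
  classical
  have hsub : ∀ (c : K) v, coeff (f - c • mon K u) v = coeff f v - c * if u = v then 1 else 0 := by
    intro c v
    rw [← coeff_mon (K := K)]
    simp [coeff]
  simp only [mem_span_mon_iff, hsub]
  constructor
  · rintro ⟨h1, h2⟩
    refine ⟨coeff f u, h1, fun v hv => ?_⟩
    by_cases h : u = v
    · subst h; simp at hv
    · exact h2 v (by simpa [h] using hv) (Ne.symm h)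
  · rintro ⟨c, hc, h⟩
    constructor
    · intro h0
      exact hr.irrefl u (h u (by simpa [h0] using hc))
    · intro v hv hne
      exact h v (by simpa [hne.symm] using hv)

theorem isLeadingMonomial_mon (hr : IsMonomialOrder r) (u : FreeMonoid (Fin n)) :
    IsLeadingMonomial r (mon K u) u :=
  (isLeadingMonomial_iff hr).2 ⟨1, one_ne_zero, by simp⟩

theorem IsLeadingMonomial.mul (hr : IsMonomialOrder r) (hf : IsLeadingMonomial r f u)
    (hg : IsLeadingMonomial r g v) : IsLeadingMonomial r (f * g) (u * v) := by
  rw [isLeadingMonomial_iff hr] at hf ⊢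
  have hgv : g ∈ Submodule.span K (mon K '' {w | w = v ∨ r w v}) :=
    mem_span_mon_iff.2 fun w hw => or_iff_not_imp_left.2 (hg.2 w hw)
  rw [isLeadingMonomial_iff hr] at hg
  obtain ⟨c, hc, hf⟩ := hf
  obtain ⟨d, hd, hg⟩ := hg
  refine ⟨c * d, mul_ne_zero hc hd, ?_⟩
  have heq : f * g - (c * d) • mon K (u * v) =
      (f - c • mon K u) * g + c • (mon K u * (g - d • mon K v)) := by
    rw [mon_mul, sub_mul, mul_sub, smul_sub, smul_mul_assoc, mul_smul_comm, smul_smul]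
    abel
  rw [heq]
  refine add_mem (mul_mem_span_mon ?_ hf hgv) (Submodule.smul_mem _ _
    (mul_mem_span_mon ?_ (Submodule.subset_span (Set.mem_image_of_mem _ (Set.mem_singleton u))) hg))
  · rintro s hs t (rfl | ht)
    · exact hr.mul_right _ hs
    · exact hr.trans (hr.mul_right _ hs) (hr.mul_left _ ht)
  · rintro s rfl t ht
    exact hr.mul_left _ ht

theorem IsLeadingMonomial.pow (hr : IsMonomialOrder r) (hf : IsLeadingMonomial r f u) (k : ℕ) :
    IsLeadingMonomial r (f ^ k) (u ^ k) := by
  induction k with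
  | zero =>
    rw [pow_zero, pow_zero, ← mon_one]
    exact isLeadingMonomial_mon hr 1
  | succ k ih => rw [pow_succ, pow_succ]; exact ih.mul hr hf

theorem IsLeadingMonomial.eq_smul_one (hr : IsMonomialOrder r) (hf : IsLeadingMonomial r f 1) :
    ∃ c : K, f = c • 1 := by
  obtain ⟨c, _, h⟩ := (isLeadingMonomial_iff hr).1 hf
  have hempty : {v : FreeMonoid (Fin n) | r v 1} = ∅ := by
    ext v
    simp only [Set.mem_ofPred, Set.mem_empty_iff_false, iff_false]
    intro hv
    by_cases h1 : v = 1
    · exact hr.irrefl 1 (h1 ▸ hv)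
    · exact hr.irrefl v (hr.trans hv (hr.one_lt h1))
  rw [hempty, Set.image_empty, Submodule.span_empty, Submodule.mem_bot, sub_eq_zero, mon_one] at h
  exact ⟨c, h⟩

theorem finite_leadingMonomials (hr : IsMonomialOrder r) {G : Set (FreeAlgebra K (Fin n))}
    (hG : G.Finite) : (leadingMonomials r G).Finite := by
  have : leadingMonomials r G = ⋃ g ∈ G, {w | IsLeadingMonomial r g w} := by
    ext w; simp [leadingMonomials]
  rw [this]
  exact hG.biUnion fun g _ => Set.Subsingleton.finite fun u hu v hv => hu.unique hr hv

variable {G : Set (FreeAlgebra K (Fin n))}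

/-- Every element outside an ideal is congruent to one whose leading monomial is normal with
respect to the leading monomials of given elements of the ideal. -/
theorem exists_isNormalWord_leadingMonomial (hr : IsMonomialOrder r)
    {I : TwoSidedIdeal (FreeAlgebra K (Fin n))} (hG : ∀ g ∈ G, g ∈ I) (hf : f ∉ I) :
    ∃ f' u, f - f' ∈ I ∧ IsLeadingMonomial r f' u ∧ IsNormalWord (leadingMonomials r G) u := by
  obtain ⟨u, hu⟩ := exists_isLeadingMonomial hr fun h : f = 0 => hf (h ▸ I.zero_mem)
  have := hr.wellOrder
  induction u using (IsWellFounded.wf (r := r)).induction generalizing f with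
  | _ u ih =>
    by_cases hn : IsNormalWord (leadingMonomials r G) u
    · exact ⟨f, u, by simp, hu, hn⟩
    simp only [IsNormalWord, not_forall, not_not] at hn
    obtain ⟨v, ⟨g, hg, hgv⟩, w, s, rfl⟩ := hn
    have hh := ((isLeadingMonomial_mon (K := K) hr w).mul hr hgv).mul hr
      (isLeadingMonomial_mon (K := K) hr s)
    have hhI : mon K w * g * mon K s ∈ I := I.mul_mem_right _ _ (I.mul_mem_left _ _ (hG g hg))
    generalize mon K w * g * mon K s = h at hh hhI
    obtain ⟨c, _, hc'⟩ := (isLeadingMonomial_iff hr).1 hu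
    obtain ⟨d, hd, hd'⟩ := (isLeadingMonomial_iff hr).1 hh
    have hsub : (c / d) • h ∈ I := by
      rw [← one_mul h, ← smul_mul_assoc]
      exact I.mul_mem_left _ _ hhI
    have hlow : f - (c / d) • h ∈ Submodule.span K (mon K '' {x | r x (w * v * s)}) := by
      have : f - (c / d) • h = (f - c • mon K (w * v * s)) -
          (c / d) • (h - d • mon K (w * v * s)) := by
        rw [smul_sub, smul_smul, div_mul_cancel₀ _ hd]; abel
      rw [this]
      exact sub_mem hc' (Submodule.smul_mem _ _ hd')
    have hfI : f - (c / d) • h ∉ I := fun hI => hf (by simpa using I.add_mem hI hsub)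
    obtain ⟨u', hu'⟩ := exists_isLeadingMonomial hr
      fun h0 : f - (c / d) • h = 0 => hfI (h0 ▸ I.zero_mem)
    obtain ⟨f', u'', h1, h2⟩ := ih u' (mem_span_mon_iff.1 hlow u' hu'.1) hfI hu'
    refine ⟨f', u'', ?_, h2⟩
    have := I.add_mem h1 hsub
    rwa [sub_right_comm, sub_add_cancel] at this

theorem IsGroebnerBasis.notMem_of_isNormalWord {I : TwoSidedIdeal (FreeAlgebra K (Fin n))}
    (hG : IsGroebnerBasis r G I) (hf : IsLeadingMonomial r f u)
    (hu : IsNormalWord (leadingMonomials r G) u) : f ∉ I := by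
  intro h
  refine (mon_mem_monomialIdeal_iff (K := K)).1 ?_ hu
  rw [← hG.span_eq]
  exact TwoSidedIdeal.subset_span ⟨u, ⟨f, h, hf⟩, rfl⟩

end LeadingMonomial

section Main

variable {K : Type*} [Field K] {n : ℕ}

theorem eq_zero_of_smul_one_mem_jacobson {A : Type*} [Ring A] [Algebra K A] {c : K}
    (h : c • (1 : A) ∈ Ring.jacobson A) : c • (1 : A) = 0 := by
  by_cases hc : c = 0
  · rw [hc, zero_smul]
  · exact Ring.eq_zero_of_mul_eq_one_of_mem_jacobson (y := c⁻¹ • 1) h (by simp [hc, smul_smul])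

theorem eq_smul_one_of_mem_gradedPiece_zero {m : Fin n → ℕ} (hm : ∀ i, 0 < m i)
    {f : FreeAlgebra K (Fin n)} (hf : f ∈ gradedPiece K m 0) : ∃ c : K, f = c • 1 := by
  have hle : gradedPiece K m 0 ≤ Submodule.span K {1} := by
    refine Submodule.span_mono ?_
    rintro _ ⟨w, hw, rfl⟩
    by_cases h : w = 1
    · rw [h, mon_one]; rfl
    · exact absurd hw (wdeg_pos hm h).ne'
  obtain ⟨c, hc⟩ := Submodule.mem_span_singleton.1 (hle hf)
  exact ⟨c, hc.symm⟩

/-- A homogeneous element of the Jacobson radical of an algebra with a semiprime associated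
monomial algebra vanishes. -/
theorem eq_zero_of_mem_quotPiece_of_mem_jacobson {m : Fin n → ℕ} (hm : ∀ i, 0 < m i)
    {r : FreeMonoid (Fin n) → FreeMonoid (Fin n) → Prop} (hr : IsMonomialOrder r)
    {G : Set (FreeAlgebra K (Fin n))} (hfin : G.Finite) (hhom : ∀ g ∈ G, IsHomog m g)
    (hG : IsGroebnerBasis r G (TwoSidedIdeal.span G))
    (hsp : IsSemiprimeRing (QuotAlg (monomialIdeal K (leadingMonomials r G))))
    {p : ℕ} {b : QuotAlg (TwoSidedIdeal.span G)} (hbp : b ∈ quotPiece m (TwoSidedIdeal.span G) p)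
    (hb : b ∈ Ring.jacobson (QuotAlg (TwoSidedIdeal.span G))) : b = 0 := by
  have hscal : ∀ f, quotAlgHom (TwoSidedIdeal.span G) f = b → (∃ c : K, f = c • 1) → b = 0 := by
    rintro f rfl ⟨c, rfl⟩
    rw [map_smul, map_one] at hb ⊢
    exact eq_zero_of_smul_one_mem_jacobson hb
  rcases Nat.eq_zero_or_pos p with rfl | hp
  · obtain ⟨f, hf, rfl⟩ := mem_quotPiece.1 hbp
    exact hscal f rfl (eq_smul_one_of_mem_gradedPiece_zero hm hf)
  by_contra hb0
  obtain ⟨f₀, rfl⟩ := quotAlgHom_surjective _ b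
  obtain ⟨f, u, hff, hfu, hu⟩ := exists_isNormalWord_leadingMonomial hr
    (fun g hg => TwoSidedIdeal.subset_span hg) (fun h => hb0 (quotAlgHom_eq_zero_iff.2 h))
  have hq : quotAlgHom (TwoSidedIdeal.span G) f₀ = quotAlgHom _ f := by
    rw [← sub_eq_zero, ← map_sub]
    exact quotAlgHom_eq_zero_iff.2 hff
  have hu1 : u ≠ 1 := by
    rintro rfl
    exact hb0 (hscal f hq.symm (hfu.eq_smul_one hr))
  rw [hq] at hbp hb
  obtain ⟨N, hN⟩ := ((finite_leadingMonomials hr hfin).image FreeMonoid.length).bddAbove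
  obtain ⟨x, hx, hlen⟩ := hu.exists_long (fun _ hv => hsp.exists_isNormalWord hv) hu1 N
  obtain ⟨w, hw⟩ := hsp.exists_isNormalWord hx
  have hpow := hw.pow fun v hv => (hN ⟨v, hv, rfl⟩).trans hlen
  have hc : IsLeadingMonomial r (f * mon K x * f * mon K w) (u * x * u * w) :=
    ((hfu.mul hr (isLeadingMonomial_mon hr x)).mul hr hfu).mul hr (isLeadingMonomial_mon hr w)
  have hcJ : quotAlgHom (TwoSidedIdeal.span G) (f * mon K x * f * mon K w) ∈
      Ring.jacobson (QuotAlg (TwoSidedIdeal.span G)) := by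
    rw [map_mul, map_mul]
    exact Ideal.mul_mem_right _ _ (Ideal.mul_mem_left _ _ hb)
  have hmon : ∀ w, quotCoaction hhom (quotAlgHom _ (mon K w)) =
      Polynomial.monomial (wdeg m w) (quotAlgHom _ (mon K w)) :=
    fun w => quotCoaction_of_mem_quotPiece hhom (mem_quotPiece.2 ⟨_, mon_mem_gradedPiece m w, rfl⟩)
  obtain ⟨k, hk⟩ := isNilpotent_of_mem_jacobson (θ := quotCoaction hhom)
    (d := p + wdeg m x + p + wdeg m w) hcJ (by omega) (by
      simp only [map_mul, hmon, quotCoaction_of_mem_quotPiece hhom hbp,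
        Polynomial.monomial_mul_monomial])
  rw [← map_pow, quotAlgHom_eq_zero_iff] at hk
  exact hG.notMem_of_isNormalWord (hc.pow hr k) (hpow k) hk

end Main

end FreeAlgGB

theorem theorem3p2 {K : Type*} [Field K] {n : ℕ}
    (m : Fin n → ℕ) (hm : ∀ i, 0 < m i)
    (r : FreeMonoid (Fin n) → FreeMonoid (Fin n) → Prop) (hr : FreeAlgGB.IsMonomialOrder r)
    (G : Set (FreeAlgebra K (Fin n))) (hfin : G.Finite)
    (hhom : ∀ g ∈ G, FreeAlgGB.IsHomog m g)
    (hG : FreeAlgGB.IsGroebnerBasis r G (TwoSidedIdeal.span G))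
    (hX : ∀ i : Fin n, FreeMonoid.of i ∉ FreeAlgGB.leadingMonomials r G)
    (hred : FreeAlgGB.IsReducedSet (FreeAlgGB.leadingMonomials r G))
    (hsp : FreeAlgGB.IsSemiprimeRing
      (FreeAlgGB.QuotAlg (FreeAlgGB.monomialIdeal K (FreeAlgGB.leadingMonomials r G)))) :
    Nonempty (GradedAlgebra (FreeAlgGB.quotPiece m (TwoSidedIdeal.span G))) ∧
      FreeAlgGB.IsSemiprimitiveRing (FreeAlgGB.QuotAlg (TwoSidedIdeal.span G)) := by
  refine ⟨FreeAlgGB.nonempty_gradedAlgebra_quotPiece hhom, ?_⟩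
  rw [FreeAlgGB.IsSemiprimitiveRing, eq_bot_iff]
  intro a ha
  have hθ := FreeAlgGB.isGradingCoaction_quotCoaction hhom
  rw [Submodule.mem_bot, ← hθ.sum_coeff a (Nat.lt_succ_self _)]
  exact Finset.sum_eq_zero fun p _ =>
    FreeAlgGB.eq_zero_of_mem_quotPiece_of_mem_jacobson hm hr hfin hhom hG hsp
      (FreeAlgGB.coeff_quotCoaction_mem hhom a p) (hθ.coeff_mem_jacobson ha p)
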